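/- Let $L>0$, $\Pi^3=[-L,L]^3$, and let $\varphi_j\in C(\mathbb S^2,L^\infty(\Pi^3))$, $j\in\mathbb N$, be a sequence of real-valued functions $\varphi_j(x,n)$, extended to $x\in\mathbb R^3$ as $2L$-periodic functions in each coordinate of $x$. Assume that there is a constant $M$ with $$\sup_{n\in\mathbb S^2}\|\varphi_j(\cdot,n)\|_{L^\infty(\Pi^3)}\le M\qquad\text{for all } j,$$ and that there is a continuous function $\sigma:[0,\infty)\to[0,\infty)$ with $\sigma(0)=0$, independent of $j$, such that $$\|\varphi_j(\cdot,n_1)-\varphi_j(\cdot,n_2)\|_{L^\infty(\Pi^3)}\le\sigma(d(n_1,n_2))\qquad\text{for all } j\in\mathbb N,\ n_1,n_2\in\mathbb S^2,$$ where $d$ is the geodesic distance on $\mathbb S^2$. For $m\in\mathbb N$ define $$T_m[\varphi](x)=\int_{\mathbb S^2}\Big(\int_{-1}^{1}\varphi(x-\lambda n,n)\,d\lambda\Big)^m dn ,$$ where $dn$ is the surface measure on $\mathbb S^2$ and where a periodic representative of $\varphi$ that is measurable in $(x,n)$ jointly is used; such a representative exists, and for almost every $x$ the integrals converge absolutely (the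 inner one for almost every $n$) and the value does not depend on the representative. Then, for every $m\in\mathbb N$, the sequence $(T_m[\varphi_j])_{j\in\mathbb N}$ is relatively compact in $L^2(\Pi^3)$. -/

import Mathlib

open MeasureTheory Set Metric
open scoped ENNReal

namespace LineIntegral

/-- Euclidean space `ℝ³`. -/
abbrev E3 : Type := EuclideanSpace ℝ (Fin 3)

/-- The unit sphere `S²` in `ℝ³`. -/
abbrev S2 : Type := sphere (0 : E3) 1

/-- The surface measure `dn` on the unit sphere (of total mass `4π`). -/
noncomputable abbrev surface : Measure S2 := (volume : Measure E3).toSphere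

/-- The geodesic distance on the unit sphere. -/
noncomputable def geodist (n₁ n₂ : S2) : ℝ :=
  InnerProductGeometry.angle (n₁ : E3) (n₂ : E3)

/-- The cube `Π³ = [-L, L]³`. -/
def cube (L : ℝ) : Set E3 := {x | ∀ i, x i ∈ Icc (-L) L}

/-- Lebesgue measure on the cube `Π³`. -/
noncomputable abbrev cubeMeasure (L : ℝ) : Measure E3 := volume.restrict (cube L)

/-- `f` is a jointly measurable function on `ℝ³ × S²`, `2L`-periodic in each of the three space
coordinates, which represents the map `φ : S² → L^∞(Π³)`: for each direction `n`, the
function `f(·, n)` belongs to the class `φ n`. -/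
structure IsPeriodicRepresentative (L : ℝ) (φ : S2 → Lp ℝ ∞ (cubeMeasure L))
    (f : E3 → S2 → ℝ) : Prop where
  measurable : Measurable (Function.uncurry f)
  periodic : ∀ (n : S2) (i : Fin 3) (x : E3), f (x + EuclideanSpace.single i (2 * L)) n = f x n
  ae_eq : ∀ n : S2, (fun x => f x n) =ᵐ[cubeMeasure L] φ n

/-- `L_n[f](x, ω) = ∫_{-1}^{1} f(x - λ n, ω) dλ`. -/
noncomputable def lineInt (n : S2) (f : E3 → S2 → ℝ) (x : E3) (ω : S2) : ℝ :=
  ∫ l in (-1 : ℝ)..1, f (x - l • (n : E3)) ω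

/-- `T_m[f](x) = ∫_{S²} (L_n[f](x, n))^m dn`. -/
noncomputable def T (m : ℕ) (f : E3 → S2 → ℝ) (x : E3) : ℝ :=
  ∫ n : S2, lineInt n f x n ^ m ∂surface

end LineIntegral

/-! Averaging over lines smooths. For u depending on position alone, the integral of (∫ u(x - t n)
dt)² over x and n equals ∫∫ u(y) u(z) k(y, z) with k in L¹: by polar coordinates, the joint law of
two points on a random line is absolutely continuous (`quasiMeasurePreserving_linePair`). Such an
expression tends to zero when u is bounded and weakly-* null (`tendsto_integral_sq_lineInt`).

Since φ_j depends on the direction too, its direction argument is frozen at points of a dense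
sequence while the direction of the line stays free; hence the two direction arguments of `lineInt`.
One weak-* extraction on E3 × ℕ serves all frozen directions (`exists_subseq_tendsto_integral_mul`).
The common modulus σ and compactness of the sphere leave finitely many of them, at a uniformly small
cost (`tendsto_lineIntSqDist`). The line integrals are then Cauchy in L² of position and direction,
and T_m is Lipschitz for that distance on bounded functions (`integral_sq_T_sub_T_le`). So every
sequence of indices has a subsequence with Cauchy values, which is relative compactness. -/

namespace LineIntegral

open Filter Topology

variable {L : ℝ}

/-! ### Polar coordinates and pairs of points on a line -/

/-- Almost every ray through the origin meets a Lebesgue null set in a null set. -/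
theorem ae_sphere_ae_pos_smul_notMem {N : Set E3} (hN : volume N = 0) :
    ∀ᵐ n : S2 ∂surface, ∀ᵐ s : ℝ, 0 < s → s • (n : E3) ∉ N := by
  have h := (volume : Measure E3).measurePreserving_homeomorphUnitSphereProd
  have h0 : ∀ᵐ y : ({0}ᶜ : Set E3) ∂((volume : Measure E3).comap (↑)), (y : E3) ∉ N := by
    rw [← ae_restrict_iff_subtype (measurableSet_singleton _).compl (p := fun y => y ∉ N)]
    exact ae_restrict_of_ae (measure_eq_zero_iff_ae_notMem.1 hN)
  have h1 : ∀ᵐ p ∂((volume : Measure E3).toSphere.prod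
      (Measure.volumeIoiPow (Module.finrank ℝ E3 - 1))), (p.2 : ℝ) • (p.1 : E3) ∉ N := by
    rw [← h.map_eq, (Homeomorph.measurableEmbedding _).ae_map_iff]
    filter_upwards [h0] with y hy
    have := congrArg Subtype.val ((homeomorphUnitSphereProd E3).symm_apply_apply y)
    rw [homeomorphUnitSphereProd_symm_apply_coe] at this
    rwa [this]
  filter_upwards [Measure.ae_ae_of_ae_prod h1] with n hn
  -- The radial measure has a density that is positive for r > 0, so its null sets are Lebesgue
  -- null.
  rw [Measure.volumeIoiPow, ae_withDensity_iff (by fun_prop),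
    ← ae_restrict_iff_subtype measurableSet_Ioi
      (p := fun r : ℝ => ENNReal.ofReal (r ^ (Module.finrank ℝ E3 - 1)) ≠ 0 → r • (n : E3) ∉ N),
    ae_restrict_iff' measurableSet_Ioi] at hn
  filter_upwards [hn] with s hs hs0
  exact hs hs0 (ENNReal.ofReal_pos.2 (pow_pos hs0 _)).ne'

/-- Almost every line through the origin meets a Lebesgue null set in a null set. -/
theorem ae_sphere_ae_smul_notMem {N : Set E3} (hN : volume N = 0) :
    ∀ᵐ n : S2 ∂surface, ∀ᵐ s : ℝ, s • (n : E3) ∉ N := by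
  -- Negative parameters on N are positive parameters on -N.
  have hN' : volume (-N) = 0 := by rwa [Measure.measure_neg]
  filter_upwards [ae_sphere_ae_pos_smul_notMem hN, ae_sphere_ae_pos_smul_notMem hN'] with n h1 h2
  have h3 := (Measure.measurePreserving_neg (volume : Measure ℝ)).quasiMeasurePreserving.ae h2
  have h4 : ∀ᵐ s : ℝ, s ≠ 0 := by simp [ae_iff]
  filter_upwards [h1, h3, h4] with s hs1 hs2 hs3
  rcases lt_or_gt_of_ne hs3 with h | h
  · simpa using hs2 (by linarith)
  · exact hs1 h

/-- The pair of points `(x - λ n, x - μ n)` on the line through `x` in direction `n`. -/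
noncomputable def linePair (q : E3 × S2 × ℝ × ℝ) : E3 × E3 :=
  (q.1 - q.2.2.1 • (q.2.1 : E3), q.1 - q.2.2.2 • (q.2.1 : E3))

theorem measurable_linePair : Measurable linePair := by
  unfold linePair; fun_prop

/-- Translating x by λ n preserves Lebesgue measure and turns the pair into (y, y - (μ - λ) n). For
almost every y the section of N over y is null, and polar coordinates around y show that almost
every (n, λ, μ) avoids it. -/
theorem quasiMeasurePreserving_linePair :
    Measure.QuasiMeasurePreserving linePair
      ((volume : Measure E3).prod (surface.prod ((volume : Measure ℝ).prod volume)))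
      ((volume : Measure E3).prod volume) := by
  refine ⟨measurable_linePair, Measure.AbsolutelyContinuous.mk fun N hNm hN => ?_⟩
  rw [Measure.map_apply measurable_linePair hNm, measure_eq_zero_iff_ae_notMem]
  have hm : MeasurableSet {q : E3 × S2 × ℝ × ℝ | linePair q ∉ N} :=
    measurable_linePair hNm.compl
  refine (Measure.ae_prod_iff_ae_ae hm).2 ((Measure.ae_ae_comm hm).2 ?_)
  have hm' : MeasurableSet {q : E3 × S2 × ℝ × ℝ |
      (q.1, q.1 - (q.2.2.2 - q.2.2.1) • (q.2.1 : E3)) ∉ N} :=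
    (show Measurable fun q : E3 × S2 × ℝ × ℝ =>
      (q.1, q.1 - (q.2.2.2 - q.2.2.1) • (q.2.1 : E3)) by fun_prop) hNm.compl
  have key : ∀ᵐ y : E3, ∀ᵐ p : S2 × ℝ × ℝ ∂(surface.prod ((volume : Measure ℝ).prod volume)),
      (y, y - (p.2.2 - p.2.1) • (p.1 : E3)) ∉ N := by
    filter_upwards [Measure.measure_ae_null_of_prod_null hN] with y hy
    have hm1 : MeasurableSet {p : S2 × ℝ × ℝ | (y, y - (p.2.2 - p.2.1) • (p.1 : E3)) ∉ N} :=
      (show Measurable fun p : S2 × ℝ × ℝ =>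
        (y, y - (p.2.2 - p.2.1) • (p.1 : E3)) by fun_prop) hNm.compl
    refine (Measure.ae_prod_iff_ae_ae hm1).2 ?_
    have hy' : volume ((fun z => y - z) ⁻¹' (Prod.mk y ⁻¹' N)) = 0 :=
      (Measure.measurePreserving_sub_left volume y).quasiMeasurePreserving.preimage_null hy
    filter_upwards [ae_sphere_ae_smul_notMem hy'] with n hn
    have hm2 : MeasurableSet {p : ℝ × ℝ | (y, y - (p.2 - p.1) • (n : E3)) ∉ N} :=
      (show Measurable fun p : ℝ × ℝ => (y, y - (p.2 - p.1) • (n : E3)) by fun_prop) hNm.compl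
    refine (Measure.ae_prod_iff_ae_ae hm2).2 (ae_of_all _ fun l => ?_)
    exact (measurePreserving_sub_right volume l).quasiMeasurePreserving.ae hn
  filter_upwards [(Measure.ae_ae_comm hm').1 key] with p hp
  filter_upwards [(measurePreserving_sub_right volume
    (p.2.1 • (p.1 : E3))).quasiMeasurePreserving.ae hp] with x hx
  convert hx using 2
  simp only [linePair, sub_smul]
  congr 1
  abel

/-! ### Weak-* convergence and compactness -/

/-- If `u p` is bounded and tends to zero weakly-* in `L^∞(ℝ³)`, then so do the products
`u p (y) u p (z)`, tested against a single function in `L¹(ℝ³ × ℝ³)`. -/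
theorem tendsto_integral_mul_mul {ι α : Type*} [MeasurableSpace α] {μ : Measure α} [SFinite μ]
    {l : Filter ι} [l.IsCountablyGenerated]
    {u : ι → α → ℝ} {B : ℝ} (hu : ∀ p, Measurable (u p)) (hB : ∀ p x, |u p x| ≤ B)
    (hw : ∀ g : α → ℝ, Integrable g μ → Tendsto (fun p => ∫ x, u p x * g x ∂μ) l (𝓝 0))
    {k : α × α → ℝ} (hk : Integrable k (μ.prod μ)) :
    Tendsto (fun p => ∫ y, u p y.1 * u p y.2 * k y ∂(μ.prod μ)) l (𝓝 0) := by
  have hint : ∀ p, Integrable (fun y : α × α => u p y.1 * u p y.2 * k y) (μ.prod μ) := fun p => by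
    refine hk.bdd_mul (c := B * B) ?_ (ae_of_all _ fun y => ?_)
    · exact (((hu p).comp measurable_fst).mul ((hu p).comp measurable_snd)).aestronglyMeasurable
    · rw [norm_mul]
      exact mul_le_mul (hB p _) (hB p _) (norm_nonneg _) ((abs_nonneg _).trans (hB p y.1))
  have heq : ∀ p, ∫ y, u p y.1 * u p y.2 * k y ∂(μ.prod μ) =
      ∫ y, u p y * ∫ z, u p z * k (y, z) ∂μ ∂μ := fun p => by
    rw [integral_prod _ (hint p)]
    refine integral_congr_ae (ae_of_all _ fun y => ?_)
    simp only [← integral_const_mul, mul_assoc]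
  simp only [heq]
  have hk1 := hk.prod_right_ae
  rw [← integral_zero α ℝ (μ := μ)]
  -- For almost every y, k(y, ·) is an admissible test function, so the inner integral tends to
  -- zero; dominated convergence handles y.
  refine tendsto_integral_filter_of_dominated_convergence
    (fun y => B * (B * ∫ z, ‖k (y, z)‖ ∂μ)) (Eventually.of_forall fun p => ?_)
    (Eventually.of_forall fun p => ?_) ?_ ?_
  · refine (hu p).aestronglyMeasurable.mul ?_
    exact ((hk.bdd_mul (c := B) ((hu p).comp measurable_snd).aestronglyMeasurable
      (ae_of_all _ fun y => hB p _)).integral_prod_left).aestronglyMeasurable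
  · filter_upwards [hk1] with y hy
    rw [norm_mul]
    refine mul_le_mul (hB p y) ?_ (norm_nonneg _) ((abs_nonneg _).trans (hB p y))
    rw [← integral_const_mul]
    refine norm_integral_le_of_norm_le (hy.norm.const_mul B) (ae_of_all _ fun z => ?_)
    rw [norm_mul]
    exact mul_le_mul_of_nonneg_right (hB p z) (norm_nonneg _)
  · exact (hk.norm.integral_prod_left.const_mul B).const_mul B
  · filter_upwards [hk1] with y hy
    exact bdd_le_mul_tendsto_zero' B (Eventually.of_forall fun p => hB p y) (hw _ hy)

/-- Averages of squares of line integrals tend to zero along a bounded weakly-* null family. -/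
theorem tendsto_integral_sq_lineInt {ι : Type*} {l : Filter ι} [l.IsCountablyGenerated]
    {u : ι → E3 → ℝ} {B : ℝ} (hu : ∀ p, Measurable (u p)) (hB : ∀ p x, |u p x| ≤ B)
    (hw : ∀ g : E3 → ℝ, Integrable g → Tendsto (fun p => ∫ x, u p x * g x) l (𝓝 0))
    (μ : Measure E3) [IsFiniteMeasure μ] (hμ : μ ≪ volume) :
    Tendsto (fun p => ∫ z : E3 × S2, (∫ t in (-1 : ℝ)..1, u p (z.1 - t • (z.2 : E3))) ^ 2
      ∂(μ.prod surface)) l (𝓝 0) := by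
  set I : Measure ℝ := volume.restrict (Ioc (-1) 1) with hI
  set ν := μ.prod (surface.prod (I.prod I)) with hν
  set ρ := ν.map linePair with hρ
  have : IsFiniteMeasure I := by rw [hI]; infer_instance
  have : IsFiniteMeasure ν := by rw [hν]; infer_instance
  have : IsFiniteMeasure ρ := by rw [hρ]; infer_instance
  have hνac : ν ≪ (volume : Measure E3).prod (surface.prod ((volume : Measure ℝ).prod volume)) :=
    hμ.prod (Measure.AbsolutelyContinuous.rfl.prod
      (Measure.absolutelyContinuous_of_le Measure.restrict_le_self |>.prod
        (Measure.absolutelyContinuous_of_le Measure.restrict_le_self)))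
  have hρac : ρ ≪ (volume : Measure E3).prod volume :=
    (hνac.map measurable_linePair).trans quasiMeasurePreserving_linePair.absolutelyContinuous
  -- The square of the line integral is a double integral in (λ, μ), so the whole is an integral
  -- against ρ; its density is the kernel k.
  have heq : ∀ p, ∫ z : E3 × S2, (∫ t in (-1 : ℝ)..1, u p (z.1 - t • (z.2 : E3))) ^ 2
      ∂(μ.prod surface) = ∫ y, u p y.1 * u p y.2 * (ρ.rnDeriv (volume.prod volume) y).toReal
        ∂((volume : Measure E3).prod volume) := fun p => by
    have hup := hu p
    have hm : Measurable fun y : E3 × E3 => u p y.1 * u p y.2 := by fun_prop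
    have hb : ∀ y : E3 × E3, ‖u p y.1 * u p y.2‖ ≤ B * B := fun y => by
      rw [norm_mul]
      exact mul_le_mul (hB p _) (hB p _) (norm_nonneg _) ((abs_nonneg _).trans (hB p y.1))
    have h1 := integral_rnDeriv_smul hρac (f := fun y : E3 × E3 => u p y.1 * u p y.2)
    simp only [smul_eq_mul] at h1
    simp only [mul_comm _ (ENNReal.toReal _)]
    rw [h1, hρ, integral_map measurable_linePair.aemeasurable hm.aestronglyMeasurable, hν]
    have hassoc := (measurePreserving_prodAssoc μ (surface) (I.prod I))
    rw [← hassoc.integral_comp (MeasurableEquiv.measurableEmbedding _),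
      integral_prod (fun q => u p (linePair (MeasurableEquiv.prodAssoc q)).1 *
        u p (linePair (MeasurableEquiv.prodAssoc q)).2)]
    · refine integral_congr_ae (ae_of_all _ fun z => ?_)
      simp only [intervalIntegral.integral_of_le (show (-1 : ℝ) ≤ 1 by norm_num), sq]
      rw [← integral_prod_mul]
      rfl
    · refine Integrable.of_bound (C := B * B) ?_ (ae_of_all _ fun z => hb _)
      exact (hm.comp (measurable_linePair.comp
        (MeasurableEquiv.measurable _))).aestronglyMeasurable
  simp only [heq]
  exact tendsto_integral_mul_mul hu hB hw Measure.integrable_toReal_rnDeriv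

/-- A bounded sequence of functions has a weakly-* convergent subsequence in `L^∞ = (L¹)*`. -/
theorem exists_subseq_tendsto_integral_mul {α : Type*} [MeasurableSpace α]
    {μ : Measure α} [TopologicalSpace.SeparableSpace (Lp ℝ 1 μ)] {h : ℕ → α → ℝ} {M : ℝ}
    (hm : ∀ j, Measurable (h j)) (hM : ∀ j x, |h j x| ≤ M) :
    ∃ θ : ℕ → ℕ, StrictMono θ ∧ ∀ g : α → ℝ, Integrable g μ →
      ∃ c, Tendsto (fun k => ∫ x, h (θ k) x * g x ∂μ) atTop (𝓝 c) := by
  have hint : ∀ j (g : α → ℝ), Integrable g μ → Integrable (fun x => h j x * g x) μ :=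
    fun j g hg => hg.bdd_mul (hm j).aestronglyMeasurable (ae_of_all _ (hM j))
  let Λ₀ : ℕ → Lp ℝ 1 μ →ₗ[ℝ] ℝ := fun j =>
    { toFun := fun g => ∫ x, h j x * g x ∂μ
      map_add' := fun g₁ g₂ => by
        rw [← integral_add (hint j _ (L1.integrable_coeFn g₁)) (hint j _ (L1.integrable_coeFn g₂))]
        refine integral_congr_ae ?_
        filter_upwards [Lp.coeFn_add g₁ g₂] with x hx
        rw [hx, Pi.add_apply, mul_add]
      map_smul' := fun c g => by
        rw [RingHom.id_apply, smul_eq_mul, ← integral_const_mul]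
        refine integral_congr_ae ?_
        filter_upwards [Lp.coeFn_smul c g] with x hx
        rw [hx, Pi.smul_apply, smul_eq_mul]
        ring }
  have hbound : ∀ j (g : Lp ℝ 1 μ), ‖Λ₀ j g‖ ≤ M * ‖g‖ := fun j g => by
    rw [L1.norm_eq_integral_norm, ← integral_const_mul]
    refine norm_integral_le_of_norm_le ((L1.integrable_coeFn g).norm.const_mul M)
      (ae_of_all _ fun x => ?_)
    rw [norm_mul]
    exact mul_le_mul_of_nonneg_right (hM j x) (norm_nonneg _)
  let Λ : ℕ → WeakDual ℝ (Lp ℝ 1 μ) := fun j =>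
    StrongDual.toWeakDual ((Λ₀ j).mkContinuous M (hbound j))
  -- The radius is |M| because 0 ≤ M is not available when α is empty.
  have hΛ : ∀ j, Λ j ∈ WeakDual.toStrongDual ⁻¹' closedBall (0 : StrongDual ℝ (Lp ℝ 1 μ)) |M| :=
    fun j => by
      rw [mem_preimage, mem_closedBall_zero_iff]
      exact ContinuousLinearMap.opNorm_le_bound _ (abs_nonneg M) fun g =>
        (hbound j g).trans (mul_le_mul_of_nonneg_right (le_abs_self M) (norm_nonneg _))
  obtain ⟨Λ', -, θ, hθ, hlim⟩ := WeakDual.isSeqCompact_closedBall ℝ (Lp ℝ 1 μ) 0 |M| hΛ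
  refine ⟨θ, hθ, fun g hg => ⟨Λ' (hg.toL1 g), ?_⟩⟩
  have := ((WeakDual.eval_continuous (hg.toL1 g)).tendsto Λ').comp hlim
  refine this.congr fun k => integral_congr_ae ?_
  filter_upwards [hg.coeFn_toL1] with x hx
  rw [hx]

/-- A set of values of a sequence is relatively compact as soon as every sequence of indices has
a subsequence along which the values form a Cauchy sequence. -/
theorem isCompact_closure_range_of_cauchySeq {X : Type*} [MetricSpace X] [CompleteSpace X]
    {τ : ℕ → X} (h : ∀ ι : ℕ → ℕ, ∃ θ : ℕ → ℕ, StrictMono θ ∧ CauchySeq (τ ∘ ι ∘ θ)) :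
    IsCompact (closure (range τ)) := by
  refine IsSeqCompact.isCompact fun x hx => ?_
  have : ∀ k : ℕ, ∃ i, dist (x k) (τ i) < 1 / ((k : ℝ) + 1) := fun k => by
    obtain ⟨_, ⟨i, rfl⟩, hi⟩ := Metric.mem_closure_iff.1 (hx k) (1 / ((k : ℝ) + 1)) (by positivity)
    exact ⟨i, hi⟩
  choose ι hι using this
  obtain ⟨θ, hθ, hc⟩ := h ι
  obtain ⟨a, ha⟩ := cauchySeq_tendsto_of_complete hc
  refine ⟨a, mem_closure_of_tendsto ha (Eventually.of_forall fun k => mem_range_self _), θ, hθ, ?_⟩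
  refine (tendsto_iff_of_dist ?_).2 ha
  refine squeeze_zero (fun _ => dist_nonneg) (fun k => (hι (θ k)).le) ?_
  exact tendsto_one_div_add_atTop_nhds_zero_nat.comp hθ.tendsto_atTop

/-! ### Periodicity and reduction to the cube -/

/-- The representative of a point modulo `2L ℤ³` in the half-open cube `[-L, L)³`. -/
noncomputable def wrap (hL : 0 < L) (x : E3) : E3 :=
  WithLp.toLp 2 fun i => toIcoMod (show 0 < 2 * L by positivity) (-L) (x i)

theorem measurable_wrap (hL : 0 < L) : Measurable (wrap hL) := by
  have hp : 0 < 2 * L := by positivity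
  have h : Measurable (toIcoMod hp (-L)) := by
    have : toIcoMod hp (-L) = fun b => -L + Int.fract ((b - -L) / (2 * L)) * (2 * L) := by
      funext b
      rw [toIcoMod_eq_add_fract_mul]
    rw [this]
    fun_prop
  refine (WithLp.measurable_toLp 2 _).comp (measurable_pi_lambda _ fun i => h.comp ?_)
  fun_prop

theorem wrap_add_single (hL : 0 < L) (x : E3) (i : Fin 3) :
    wrap hL (x + EuclideanSpace.single i (2 * L)) = wrap hL x := by
  ext j
  rcases eq_or_ne j i with rfl | h
  · simp [wrap]
  · simp [wrap, h]

theorem wrap_mem_cube (hL : 0 < L) (x : E3) : wrap hL x ∈ cube L := fun i => by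
  have h := toIcoMod_mem_Ico (show 0 < 2 * L by positivity) (-L) (x i)
  exact ⟨h.1, by simp only [wrap]; linarith [h.2]⟩

theorem measurableSet_cube : MeasurableSet (cube L) := by
  have : cube L = ⋂ i, (fun x : E3 => x i) ⁻¹' Icc (-L) L := by ext; simp [cube]
  rw [this]
  exact MeasurableSet.iInter fun i => (by fun_prop : Measurable fun x : E3 => x i) measurableSet_Icc

instance isFiniteMeasure_cubeMeasure : IsFiniteMeasure (cubeMeasure L) := by
  refine isFiniteMeasure_restrict.2 (Bornology.IsBounded.measure_lt_top ?_).ne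
  refine (Metric.isBounded_iff_subset_closedBall 0).2 ⟨Real.sqrt (∑ _i : Fin 3, L ^ 2), ?_⟩
  intro x hx
  rw [mem_closedBall_zero_iff, EuclideanSpace.norm_eq]
  refine Real.sqrt_le_sqrt (Finset.sum_le_sum fun i _ => ?_)
  rw [Real.norm_eq_abs]
  exact pow_le_pow_left₀ (abs_nonneg _) (abs_le.2 (hx i)) 2

/-- The only points of the cube that move lie on a face x i = L, a null set. -/
theorem wrap_ae_eq (hL : 0 < L) : ∀ᵐ x ∂cubeMeasure L, wrap hL x = x := by
  have h0 : ∀ i : Fin 3, ∀ᵐ x : E3, x i ≠ L := fun i => by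
    have h1 : ∀ᵐ y : Fin 3 → ℝ, y i ≠ L :=
      (Measure.quasiMeasurePreserving_eval (fun _ : Fin 3 => (volume : Measure ℝ)) i).ae
        (show ∀ᵐ t : ℝ, t ≠ L by simp [ae_iff])
    exact (PiLp.volume_preserving_ofLp (Fin 3)).quasiMeasurePreserving.ae h1
  rw [ae_restrict_iff' measurableSet_cube]
  filter_upwards [ae_all_iff.2 h0] with x hx hxc
  ext i
  refine (toIcoMod_eq_self _).2 ⟨(hxc i).1, ?_⟩
  have := lt_of_le_of_ne (hxc i).2 (hx i)
  linarith

/-- The lattice `2L ℤ³`. -/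
noncomputable def latticePoint (L : ℝ) (k : Fin 3 → ℤ) : E3 :=
  ∑ i, k i • EuclideanSpace.single i (2 * L)

theorem wrap_add_latticePoint (hL : 0 < L) (x : E3) :
    ∃ k, wrap hL x + latticePoint L k = x := by
  refine ⟨fun i => toIcoDiv (show 0 < 2 * L by positivity) (-L) (x i), ?_⟩
  ext j
  simp [latticePoint, wrap, Finset.sum_apply, Pi.single_apply]

theorem add_latticePoint_of_periodic {β : Type*} {f : E3 → β}
    (hf : ∀ (i : Fin 3) x, f (x + EuclideanSpace.single i (2 * L)) = f x) (k : Fin 3 → ℤ) (x : E3) :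
    f (x + latticePoint L k) = f x := by
  have h1 : ∀ i, Function.Periodic f (k i • EuclideanSpace.single i (2 * L) : E3) := fun i =>
    Function.Periodic.zsmul (hf i) (k i)
  rw [latticePoint, Fin.sum_univ_three]
  exact ((h1 0).add_period (h1 1)).add_period (h1 2) x

/-- A periodic property which holds almost everywhere on the cube holds almost everywhere. -/
theorem ae_of_ae_cube (hL : 0 < L) {P : E3 → Prop}
    (hP : ∀ (i : Fin 3) x, P (x + EuclideanSpace.single i (2 * L)) = P x)
    (h : ∀ᵐ x ∂cubeMeasure L, P x) : ∀ᵐ x : E3, P x := by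
  rw [ae_restrict_iff' measurableSet_cube] at h
  have h1 : ∀ᵐ x : E3, ∀ k, x - latticePoint L k ∈ cube L → P (x - latticePoint L k) :=
    ae_all_iff.2 fun k => (measurePreserving_sub_right volume _).quasiMeasurePreserving.ae h
  filter_upwards [h1] with x hx
  obtain ⟨k, hk⟩ := wrap_add_latticePoint hL x
  have h2 := hx k
  rw [← hk, add_sub_cancel_right] at h2
  rw [← hk, add_latticePoint_of_periodic hP]
  exact h2 (wrap_mem_cube hL x)

/-! ### Jointly measurable bounded representatives -/

theorem ae_abs_sub_le_norm_sub {α : Type*} [MeasurableSpace α] {μ : Measure α}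
    (f g : Lp ℝ ∞ μ) : ∀ᵐ x ∂μ, |f x - g x| ≤ ‖f - g‖ := by
  have h := ae_le_eLpNormEssSup (f := (f - g : Lp ℝ ∞ μ)) (μ := μ)
  filter_upwards [h, Lp.coeFn_sub f g] with x hx hs
  rw [← Real.norm_eq_abs, ← Pi.sub_apply, ← hs, Lp.norm_def, eLpNorm_exponent_top]
  refine (ENNReal.ofReal_le_iff_le_toReal ?_).1 ?_
  · rw [← eLpNorm_exponent_top]; exact Lp.eLpNorm_ne_top _
  · rwa [ofReal_norm]

/-- A continuous map into `L^∞` has a periodic jointly measurable representative. -/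
theorem exists_isPeriodicRepresentative (hL : 0 < L) (φ : C(S2, Lp ℝ ∞ (cubeMeasure L))) :
    ∃ f, IsPeriodicRepresentative L φ f := by
  classical
  have : Nonempty S2 := ⟨⟨EuclideanSpace.single 0 1, by simp⟩⟩
  let d := TopologicalSpace.denseSeq S2
  let g : ℕ → E3 → ℝ := fun i x => φ (d i) (wrap hL x)
  have hex : ∀ (k : ℕ) (n : S2), ∃ i, ‖φ n - φ (d i)‖ < 1 / ((k : ℝ) + 1) := fun k n => by
    have hU : IsOpen {n' : S2 | ‖φ n - φ n'‖ < 1 / ((k : ℝ) + 1)} :=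
      isOpen_lt (by fun_prop) continuous_const
    obtain ⟨i, hi⟩ := (TopologicalSpace.denseRange_denseSeq S2).exists_mem_open hU
      ⟨n, by simp only [mem_ofPred_eq, sub_self, norm_zero]; positivity⟩
    exact ⟨i, hi⟩
  -- Taking the least admissible index makes the choice measurable in n. The limsup below gives a
  -- value even where the approximations diverge.
  let idx : ℕ → S2 → ℕ := fun k n => Nat.find (hex k n)
  have hidx : ∀ k, Measurable (idx k) := fun k => measurable_find _ fun i =>
    (isOpen_lt (by fun_prop) continuous_const).measurableSet
  have hg : ∀ i, Measurable (g i) := fun i =>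
    (Lp.stronglyMeasurable (φ (d i))).measurable.comp (measurable_wrap hL)
  refine ⟨fun x n => limsup (fun k => g (idx k n) x) atTop, ?_, fun n i x => ?_, fun n => ?_⟩
  · refine Measurable.limsup fun k => ?_
    have h1 : Measurable fun p : E3 × ℕ => g p.2 p.1 := measurable_from_prod_countable_left hg
    exact h1.comp (measurable_fst.prodMk ((hidx k).comp measurable_snd))
  · simp only [g, wrap_add_single]
  · have h1 : ∀ᵐ x ∂cubeMeasure L, ∀ i, |φ n x - φ (d i) x| ≤ ‖φ n - φ (d i)‖ :=
      ae_all_iff.2 fun i => ae_abs_sub_le_norm_sub _ _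
    filter_upwards [h1, wrap_ae_eq hL] with x hx hw
    refine Tendsto.limsup_eq (tendsto_iff_dist_tendsto_zero.2 ?_)
    refine squeeze_zero (fun _ => dist_nonneg) (fun k => ?_)
      tendsto_one_div_add_atTop_nhds_zero_nat
    rw [dist_comm, Real.dist_eq]
    simp only [g, hw]
    exact (hx _).trans (Nat.find_spec (hex k n)).le

namespace IsPeriodicRepresentative

variable {φ : S2 → Lp ℝ ∞ (cubeMeasure L)} {f g : E3 → S2 → ℝ}

theorem ae_eq_of_isPeriodicRepresentative (hL : 0 < L) (hf : IsPeriodicRepresentative L φ f)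
    (hg : IsPeriodicRepresentative L φ g) (n : S2) : ∀ᵐ x : E3, f x n = g x n :=
  ae_of_ae_cube hL (fun i x => by rw [hf.periodic, hg.periodic])
    ((hf.ae_eq n).trans (hg.ae_eq n).symm)

theorem ae_abs_sub_le (hL : 0 < L) (hf : IsPeriodicRepresentative L φ f) (n₁ n₂ : S2) :
    ∀ᵐ x : E3, |f x n₁ - f x n₂| ≤ ‖φ n₁ - φ n₂‖ := by
  refine ae_of_ae_cube hL (fun i x => by rw [hf.periodic, hf.periodic]) ?_
  filter_upwards [hf.ae_eq n₁, hf.ae_eq n₂, ae_abs_sub_le_norm_sub (φ n₁) (φ n₂)] with x h1 h2 h3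
  rwa [h1, h2]

/-- Truncating a representative at the essential bound gives a bounded representative. -/
theorem clip {M : ℝ} (hf : IsPeriodicRepresentative L φ f) (hM : ∀ n, ‖φ n‖ ≤ M) :
    IsPeriodicRepresentative L φ fun x n => max (-M) (min M (f x n)) where
  measurable := measurable_const.max (measurable_const.min hf.measurable)
  periodic n i x := by rw [hf.periodic]
  ae_eq n := by
    filter_upwards [hf.ae_eq n, ae_abs_sub_le_norm_sub (φ n) 0, Lp.coeFn_zero ℝ ∞ (cubeMeasure L)]
      with x h1 h2 h3
    rw [h3, Pi.zero_apply, sub_zero, sub_zero] at h2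
    have h4 := abs_le.1 (h2.trans (hM n))
    rw [h1, min_eq_right h4.2, max_eq_right h4.1]

end IsPeriodicRepresentative

theorem exists_bounded_isPeriodicRepresentative (hL : 0 < L)
    (φ : C(S2, Lp ℝ ∞ (cubeMeasure L))) {M : ℝ} (hM : ∀ n, ‖φ n‖ ≤ M) :
    ∃ f, IsPeriodicRepresentative L φ f ∧ ∀ x n, |f x n| ≤ M := by
  obtain ⟨f, hf⟩ := exists_isPeriodicRepresentative hL φ
  have : Nonempty S2 := ⟨⟨EuclideanSpace.single 0 1, by simp⟩⟩
  have hM0 : 0 ≤ M := (norm_nonneg _).trans (hM (Classical.arbitrary S2))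
  exact ⟨_, hf.clip hM, fun x n => abs_le.2
    ⟨le_max_left _ _, max_le (by linarith) (min_le_left _ _)⟩⟩

/-! ### The modulus of continuity and finite nets on the sphere -/

theorem continuous_geodist_left (n₀ : S2) : Continuous fun n => geodist n n₀ := by
  unfold geodist InnerProductGeometry.angle
  refine Real.continuous_arccos.comp (Continuous.div (by fun_prop) (by fun_prop) fun n => ?_)
  simp

theorem geodist_comm (n₁ n₂ : S2) : geodist n₁ n₂ = geodist n₂ n₁ :=
  InnerProductGeometry.angle_comm _ _

theorem continuous_modulus_geodist {σ : ℝ → ℝ} (hσ : ContinuousOn σ (Ici 0)) (n₀ : S2) :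
    Continuous fun n => σ (geodist n n₀) :=
  hσ.comp_continuous (continuous_geodist_left n₀) fun _ => InnerProductGeometry.angle_nonneg _ _

/-- For a modulus of continuity `σ`, finitely many points of a dense sequence are `ε`-dense. -/
theorem exists_finset_modulus_lt {σ : ℝ → ℝ} (hσ : ContinuousOn σ (Ici 0)) (hσ0 : σ 0 = 0)
    {d : ℕ → S2} (hd : DenseRange d) {ε : ℝ} (hε : 0 < ε) :
    ∃ F : Finset ℕ, ∀ n, ∃ i ∈ F, σ (geodist n (d i)) < ε := by
  have hc := continuous_modulus_geodist hσ
  have hself : ∀ n : S2, geodist n n = 0 := fun n =>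
    InnerProductGeometry.angle_self (ne_zero_of_mem_unit_sphere n)
  obtain ⟨F, hF⟩ := isCompact_univ.elim_finite_subcover
    (fun i => {n | σ (geodist n (d i)) < ε}) (fun i => isOpen_lt (hc _) continuous_const)
    (fun n _ => by
      have ho : IsOpen {n' | σ (geodist n' n) < ε} := isOpen_lt (hc n) continuous_const
      obtain ⟨i, hi⟩ := hd.exists_mem_open ho ⟨n, by rwa [mem_ofPred_eq, hself, hσ0]⟩
      exact mem_iUnion.2 ⟨i, by rw [mem_ofPred_eq, geodist_comm]; exact hi⟩)
  refine ⟨F, fun n => ?_⟩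
  simpa using hF (mem_univ n)

/-! ### Measurability and bounds for line integrals -/

section Bounded

variable {f : E3 → S2 → ℝ} {M : ℝ}

theorem intervalIntegrable_line (hf : Measurable (Function.uncurry f)) (hM : ∀ x n, |f x n| ≤ M)
    (x : E3) (n ω : S2) :
    IntervalIntegrable (fun l : ℝ => f (x - l • (n : E3)) ω) volume (-1) 1 := by
  have : Measurable fun l : ℝ => f (x - l • (n : E3)) ω :=
    hf.comp (f := fun l : ℝ => (x - l • (n : E3), ω)) (by fun_prop)
  have hc : IntervalIntegrable (fun _ : ℝ => M) volume (-1) 1 := intervalIntegrable_const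
  exact hc.mono_fun this.aestronglyMeasurable
    (ae_of_all _ fun l => (hM _ _).trans (le_abs_self M))

theorem measurable_lineInt (hf : Measurable (Function.uncurry f)) :
    Measurable fun z : E3 × S2 => lineInt z.2 f z.1 z.2 := by
  simp only [lineInt, intervalIntegral.integral_of_le (show (-1 : ℝ) ≤ 1 by norm_num)]
  have : Measurable fun q : (E3 × S2) × ℝ => f (q.1.1 - q.2 • (q.1.2 : E3)) q.1.2 :=
    hf.comp (f := fun q : (E3 × S2) × ℝ => (q.1.1 - q.2 • (q.1.2 : E3), q.1.2)) (by fun_prop)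
  exact (this.stronglyMeasurable.integral_prod_right).measurable

theorem abs_lineInt_le (hM : ∀ x n, |f x n| ≤ M) (x : E3) (n ω : S2) :
    |lineInt n f x ω| ≤ 2 * M := by
  have := intervalIntegral.norm_integral_le_of_norm_le_const (a := (-1 : ℝ)) (b := 1)
    (f := fun l : ℝ => f (x - l • (n : E3)) ω) (C := M) fun l _ => hM _ _
  rw [Real.norm_eq_abs] at this
  refine this.trans (le_of_eq ?_)
  norm_num
  ring

theorem integrable_lineInt_pow (hf : Measurable (Function.uncurry f)) (hM : ∀ x n, |f x n| ≤ M)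
    (m : ℕ) (x : E3) : Integrable (fun n : S2 => lineInt n f x n ^ m) surface := by
  have h1 : Measurable fun n : S2 => lineInt n f x n :=
    (measurable_lineInt hf).comp (measurable_const.prodMk measurable_id)
  refine Integrable.of_bound (C := (2 * M) ^ m) (h1.pow_const m).aestronglyMeasurable
    (ae_of_all _ fun n => ?_)
  rw [norm_pow]
  exact pow_le_pow_left₀ (norm_nonneg _) (abs_lineInt_le hM x n n) m

theorem measurable_T (hf : Measurable (Function.uncurry f)) (m : ℕ) : Measurable (T m f) :=
  (((measurable_lineInt hf).pow_const m).stronglyMeasurable.integral_prod_right).measurable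

theorem memLp_T (hf : Measurable (Function.uncurry f)) (hM : ∀ x n, |f x n| ≤ M) (m : ℕ)
    (μ : Measure E3) [IsFiniteMeasure μ] (p : ℝ≥0∞) : MemLp (T m f) p μ := by
  refine MemLp.of_bound (measurable_T hf m).aestronglyMeasurable
    ((2 * M) ^ m * (surface : Measure S2).real univ) (ae_of_all _ fun x => ?_)
  refine norm_integral_le_of_norm_le_const (ae_of_all _ fun n => ?_)
  rw [norm_pow]
  exact pow_le_pow_left₀ (norm_nonneg _) (abs_lineInt_le hM x n n) m

end Bounded

/-- If a relation between jointly measurable functions holds for every direction at almost every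
point, then it holds along almost every segment. -/
theorem ae_ae_ae_line {P : E3 → S2 → Prop} (hPm : MeasurableSet {q : E3 × S2 | P q.1 q.2})
    (hP : ∀ n, ∀ᵐ x : E3, P x n) :
    ∀ᵐ z : E3 × S2 ∂(volume.prod surface), ∀ᵐ l : ℝ, P (z.1 - l • (z.2 : E3)) z.2 := by
  have hm : MeasurableSet {q : E3 × S2 × ℝ | P (q.1 - q.2.2 • (q.2.1 : E3)) q.2.1} :=
    (show Measurable fun q : E3 × S2 × ℝ => (q.1 - q.2.2 • (q.2.1 : E3), q.2.1) by fun_prop) hPm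
  have h : ∀ᵐ p : S2 × ℝ ∂(surface.prod volume), ∀ᵐ x : E3, P (x - p.2 • (p.1 : E3)) p.1 :=
    ae_of_all _ fun p =>
      (measurePreserving_sub_right volume (p.2 • (p.1 : E3))).quasiMeasurePreserving.ae (hP p.1)
  have h1 := (Measure.ae_prod_iff_ae_ae hm).2 ((Measure.ae_ae_comm hm).2 h)
  exact Measure.ae_ae_of_ae_prod ((measurePreserving_prodAssoc volume surface
    volume).quasiMeasurePreserving.ae h1)

/-- Cauchy–Schwarz against the constant 1, read off from ∫ (S h - I)² ≥ 0. -/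
theorem sq_integral_le_measureReal_mul {α : Type*} [MeasurableSpace α] {μ : Measure α}
    [IsFiniteMeasure μ] {h : α → ℝ} (h1 : Integrable h μ) (h2 : Integrable (fun x => h x ^ 2) μ) :
    (∫ x, h x ∂μ) ^ 2 ≤ μ.real univ * ∫ x, h x ^ 2 ∂μ := by
  set S := μ.real univ with hS
  set I := ∫ x, h x ∂μ with hI
  rcases (measureReal_nonneg : 0 ≤ μ.real univ).eq_or_lt with h0 | h0
  · have : μ = 0 := by
      rw [← Measure.measure_univ_eq_zero]
      exact (measureReal_eq_zero_iff).1 h0.symm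
    simp [hI, this]
  · have key : ∫ x, (S * h x - I) ^ 2 ∂μ = S * (S * ∫ x, h x ^ 2 ∂μ - I ^ 2) := by
      have : ∀ x, (S * h x - I) ^ 2 = S ^ 2 * h x ^ 2 - 2 * S * I * h x + I ^ 2 := fun x => by ring
      simp only [this]
      have h3 : Integrable (fun x => S ^ 2 * h x ^ 2 - 2 * S * I * h x) μ :=
        (h2.const_mul _).sub (h1.const_mul _)
      rw [integral_add h3 (integrable_const _),
        integral_sub (h2.const_mul _) (h1.const_mul _), integral_const_mul, integral_const_mul,
        integral_const, smul_eq_mul, ← hS, ← hI]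
      ring
    have hpos : 0 ≤ S * (S * ∫ x, h x ^ 2 ∂μ - I ^ 2) := key ▸ integral_nonneg fun x => sq_nonneg _
    linarith [nonneg_of_mul_nonneg_right hpos h0]

theorem integrable_mul_indicator_singleton {α : Type*} [MeasurableSpace α] {μ : Measure α}
    [SFinite μ] {g : α → ℝ} (hg : Integrable g μ) (i : ℕ) :
    Integrable (fun q : α × ℕ => g q.1 * indicator {i} (fun _ => (1 : ℝ)) q.2)
      (μ.prod Measure.count) := by
  refine hg.mul_prod ((integrable_indicator_iff (measurableSet_singleton i)).2 ?_)
  exact integrableOn_const (by simp)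

/-- Weak-* convergence on α × ℕ thus contains weak-* convergence of every slice, which replaces a
diagonal argument. -/
theorem integral_mul_indicator_singleton {α : Type*} [MeasurableSpace α] {μ : Measure α}
    [SFinite μ] {h : α → ℕ → ℝ} {M : ℝ} (hm : ∀ n, Measurable fun x => h x n)
    (hM : ∀ x n, |h x n| ≤ M) {g : α → ℝ} (hg : Integrable g μ) (i : ℕ) :
    ∫ q : α × ℕ, h q.1 q.2 * (g q.1 * indicator {i} (fun _ => (1 : ℝ)) q.2)
      ∂(μ.prod Measure.count) = ∫ x, h x i * g x ∂μ := by
  have hm' : Measurable fun q : α × ℕ => h q.1 q.2 := measurable_from_prod_countable_left hm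
  rw [integral_prod _ ((integrable_mul_indicator_singleton hg i).bdd_mul
    hm'.aestronglyMeasurable (ae_of_all _ fun q => hM q.1 q.2))]
  refine integral_congr_ae (ae_of_all _ fun x => ?_)
  have : (fun n => h x n * (g x * indicator {i} (fun _ => (1 : ℝ)) n)) =
      indicator {i} fun n => h x n * g x := by
    funext n
    by_cases hn : n = i <;> simp [hn]
  simp only [this]
  rw [integral_indicator (measurableSet_singleton i), integral_singleton]
  simp

theorem norm_toLp_sq {α : Type*} [MeasurableSpace α] {μ : Measure α} {f : α → ℝ}
    (hf : MemLp f 2 μ) : ‖hf.toLp f‖ ^ 2 = ∫ x, f x ^ 2 ∂μ := by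
  rw [← real_inner_self_eq_norm_sq, L2.inner_def]
  refine integral_congr_ae ?_
  filter_upwards [hf.coeFn_toLp] with x hx
  rw [hx, real_inner_self_eq_norm_sq, Real.norm_eq_abs, sq_abs]

/-! ### L² estimates and the Cauchy property -/

/-- The squared distance on `E3 × S2` between the line integrals of `f` and `g`. -/
noncomputable def lineIntSqDist (μ : Measure E3) (f g : E3 → S2 → ℝ) : ℝ :=
  ∫ z : E3 × S2, (lineInt z.2 f z.1 z.2 - lineInt z.2 g z.1 z.2) ^ 2 ∂(μ.prod surface)

section Estimates

variable {f g : E3 → S2 → ℝ} {M : ℝ}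

/-- Combines the Lipschitz bound for t ↦ t^m, Cauchy–Schwarz on the sphere, and Fubini. -/
theorem integral_sq_T_sub_T_le (hf : Measurable (Function.uncurry f)) (hfM : ∀ x n, |f x n| ≤ M)
    (hg : Measurable (Function.uncurry g)) (hgM : ∀ x n, |g x n| ≤ M) (m : ℕ)
    (μ : Measure E3) [IsFiniteMeasure μ] :
    ∫ x, (T m f x - T m g x) ^ 2 ∂μ ≤
      (surface : Measure S2).real univ * (m * (2 * M) ^ (m - 1)) ^ 2 * lineIntSqDist μ f g := by
  set S := (surface : Measure S2).real univ
  -- Lipschitz constant of t ↦ t^m on [-2M, 2M]. For m = 0 the truncated exponent is harmless, as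
  -- the factor m vanishes.
  set K := (m * (2 * M) ^ (m - 1) : ℝ)
  have hbm : Measurable fun z : E3 × S2 => lineInt z.2 f z.1 z.2 - lineInt z.2 g z.1 z.2 :=
    (measurable_lineInt hf).sub (measurable_lineInt hg)
  have hb : ∀ x n, |lineInt n f x n - lineInt n g x n| ≤ 4 * M := fun x n => by
    have h1 := abs_lineInt_le hfM x n n
    have h2 := abs_lineInt_le hgM x n n
    linarith [abs_sub (lineInt n f x n) (lineInt n g x n)]
  have hbsq : ∀ x n, ‖(lineInt n f x n - lineInt n g x n) ^ 2‖ ≤ (4 * M) ^ 2 := fun x n => by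
    rw [norm_pow]
    exact pow_le_pow_left₀ (norm_nonneg _) (hb x n) 2
  have hint : Integrable (fun z : E3 × S2 =>
      (lineInt z.2 f z.1 z.2 - lineInt z.2 g z.1 z.2) ^ 2) (μ.prod surface) :=
    Integrable.of_bound (hbm.pow_const 2).aestronglyMeasurable _ (ae_of_all _ fun z => hbsq _ _)
  have hintx : ∀ x, Integrable (fun n : S2 =>
      (lineInt n f x n - lineInt n g x n) ^ 2) surface := fun x =>
    Integrable.of_bound ((hbm.comp (measurable_const.prodMk measurable_id)).pow_const
      2).aestronglyMeasurable _ (ae_of_all _ fun n => hbsq x n)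
  have hpt : ∀ x n, (lineInt n f x n ^ m - lineInt n g x n ^ m) ^ 2 ≤
      K ^ 2 * (lineInt n f x n - lineInt n g x n) ^ 2 := fun x n => by
    rw [← mul_pow, sq_le_sq, abs_mul]
    refine (abs_pow_sub_pow_le _ _ m).trans ?_
    rw [mul_assoc, mul_comm]
    refine mul_le_mul_of_nonneg_right (le_trans ?_ (le_abs_self K)) (abs_nonneg _)
    refine mul_le_mul_of_nonneg_left ?_ (Nat.cast_nonneg m)
    exact pow_le_pow_left₀ (le_max_of_le_left (abs_nonneg _))
      (max_le (abs_lineInt_le hfM x n n) (abs_lineInt_le hgM x n n)) _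
  have hpow : ∀ x, Integrable (fun n : S2 => lineInt n f x n ^ m - lineInt n g x n ^ m) surface :=
    fun x => (integrable_lineInt_pow hf hfM m x).sub (integrable_lineInt_pow hg hgM m x)
  have hpow2 : ∀ x, Integrable (fun n : S2 =>
      (lineInt n f x n ^ m - lineInt n g x n ^ m) ^ 2) surface := fun x => by
    refine ((hintx x).const_mul (K ^ 2)).mono' ((hpow x).aestronglyMeasurable.pow 2)
      (ae_of_all _ fun n => ?_)
    rw [Real.norm_of_nonneg (sq_nonneg _)]
    exact hpt x n
  have hT : ∀ x, (T m f x - T m g x) ^ 2 ≤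
      S * K ^ 2 * ∫ n : S2, (lineInt n f x n - lineInt n g x n) ^ 2 ∂surface := fun x => by
    rw [T, T, ← integral_sub (integrable_lineInt_pow hf hfM m x) (integrable_lineInt_pow hg hgM m x)]
    refine (sq_integral_le_measureReal_mul (hpow x) (hpow2 x)).trans ?_
    rw [mul_assoc, ← integral_const_mul (K ^ 2)]
    exact mul_le_mul_of_nonneg_left (integral_mono (hpow2 x) ((hintx x).const_mul _) (hpt x))
      measureReal_nonneg
  rw [lineIntSqDist, integral_prod _ hint, ← integral_const_mul]
  refine integral_mono_of_nonneg (ae_of_all _ fun x => sq_nonneg _)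
    (hint.integral_prod_left.const_mul _) (ae_of_all _ hT)

/-- Only the frozen argument changes: both integrals run over the same segment, with parameter
interval of length 2. -/
theorem abs_lineInt_sub_lineInt_le (hf : Measurable (Function.uncurry f))
    (hM : ∀ x n, |f x n| ≤ M) {x : E3} {n ω : S2} {η : ℝ}
    (h : ∀ᵐ l : ℝ, |f (x - l • (n : E3)) n - f (x - l • (n : E3)) ω| ≤ η) :
    |lineInt n f x n - lineInt n f x ω| ≤ 2 * η := by
  rw [lineInt, lineInt, ← intervalIntegral.integral_sub (intervalIntegrable_line hf hM x n n)
    (intervalIntegrable_line hf hM x n ω)]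
  have := intervalIntegral.norm_integral_le_of_norm_le_const_ae (a := (-1 : ℝ)) (b := 1)
    (f := fun l : ℝ => f (x - l • (n : E3)) n - f (x - l • (n : E3)) ω) (C := η)
    (h.mono fun l hl _ => hl)
  rw [Real.norm_eq_abs] at this
  refine this.trans (le_of_eq ?_)
  norm_num
  ring

end Estimates

/-- The line integrals of a bounded equicontinuous sequence which converges weakly-* in a dense set
of directions form a Cauchy sequence in `L²`. -/
theorem tendsto_lineIntSqDist {f : ℕ → E3 → S2 → ℝ} {M : ℝ}
    (hf : ∀ j, Measurable (Function.uncurry (f j))) (hM : ∀ j x n, |f j x n| ≤ M)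
    {σ : ℝ → ℝ} (hσ : ContinuousOn σ (Ici 0)) (hσ0 : σ 0 = 0)
    {d : ℕ → S2} (hd : DenseRange d)
    (hequi : ∀ j n i, ∀ᵐ x : E3, |f j x n - f j x (d i)| ≤ σ (geodist n (d i)))
    (hw : ∀ i (g : E3 → ℝ), Integrable g →
      ∃ c, Tendsto (fun j => ∫ x, f j x (d i) * g x) atTop (𝓝 c))
    (μ : Measure E3) [IsFiniteMeasure μ] (hμ : μ ≪ volume) :
    Tendsto (fun p : ℕ × ℕ => lineIntSqDist μ (f p.1) (f p.2)) atTop (𝓝 0) := by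
  have hfd : ∀ j i, Measurable fun x => f j x (d i) := fun j i =>
    (hf j).comp (f := fun x => (x, d i)) (by fun_prop)
  -- The line keeps its direction `z.2` while the function is frozen at `d i`, so the integrand
  -- depends on position alone.
  let c : ℕ → ℕ × ℕ → E3 × S2 → ℝ := fun i p z =>
    ∫ t in (-1 : ℝ)..1, (f p.1 (z.1 - t • (z.2 : E3)) (d i) - f p.2 (z.1 - t • (z.2 : E3)) (d i))
  have hc_eq : ∀ i p z, c i p z = lineInt z.2 (f p.1) z.1 (d i) - lineInt z.2 (f p.2) z.1 (d i) :=
    fun i p z => intervalIntegral.integral_sub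
      (intervalIntegrable_line (hf p.1) (hM p.1) z.1 z.2 (d i))
      (intervalIntegrable_line (hf p.2) (hM p.2) z.1 z.2 (d i))
  have hc : ∀ i, Tendsto (fun p => ∫ z, c i p z ^ 2 ∂(μ.prod surface)) atTop (𝓝 0) := fun i => by
    refine tendsto_integral_sq_lineInt (B := 2 * M)
      (u := fun (p : ℕ × ℕ) x => f p.1 x (d i) - f p.2 x (d i))
      (fun p => (hfd p.1 i).sub (hfd p.2 i)) (fun p x => ?_) (fun g hg => ?_) μ hμ
    · linarith [abs_sub (f p.1 x (d i)) (f p.2 x (d i)), hM p.1 x (d i), hM p.2 x (d i)]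
    · obtain ⟨a, ha⟩ := hw i g hg
      have hi : ∀ j, Integrable fun x => f j x (d i) * g x := fun j =>
        hg.bdd_mul (hfd j i).aestronglyMeasurable (ae_of_all _ fun x => hM j x (d i))
      have h1 : Tendsto (fun p : ℕ × ℕ => (∫ x, f p.1 x (d i) * g x) - ∫ x, f p.2 x (d i) * g x)
          atTop (𝓝 (a - a)) := by
        rw [← prod_atTop_atTop_eq]
        exact (ha.comp tendsto_fst).sub (ha.comp tendsto_snd)
      rw [sub_self] at h1
      refine h1.congr fun p => ?_
      rw [← integral_sub (hi _) (hi _)]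
      simp only [sub_mul]
  have hcm : ∀ i p, Measurable (c i p) := fun i p => by
    have : c i p = fun z => lineInt z.2 (fun x _ => f p.1 x (d i)) z.1 z.2 -
        lineInt z.2 (fun x _ => f p.2 x (d i)) z.1 z.2 := funext fun z => hc_eq i p z
    rw [this]
    have hm : ∀ j, Measurable (Function.uncurry fun (x : E3) (_ : S2) => f j x (d i)) :=
      fun j => (hfd j i).comp measurable_fst
    exact (measurable_lineInt (hm _)).sub (measurable_lineInt (hm _))
  have hci : ∀ i p, Integrable (fun z => c i p z ^ 2) (μ.prod surface) := fun i p => by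
    refine Integrable.of_bound (C := (4 * M) ^ 2) ((hcm i p).pow_const 2).aestronglyMeasurable
      (ae_of_all _ fun z => ?_)
    rw [norm_pow]
    refine pow_le_pow_left₀ (norm_nonneg _) ?_ 2
    rw [Real.norm_eq_abs, hc_eq]
    linarith [abs_sub (lineInt z.2 (f p.1) z.1 (d i)) (lineInt z.2 (f p.2) z.1 (d i)),
      abs_lineInt_le (hM p.1) z.1 z.2 (d i), abs_lineInt_le (hM p.2) z.1 z.2 (d i)]
  have hline : ∀ᵐ z : E3 × S2 ∂(μ.prod surface), ∀ᵐ l : ℝ, ∀ j i,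
      |f j (z.1 - l • (z.2 : E3)) z.2 - f j (z.1 - l • (z.2 : E3)) (d i)| ≤
        σ (geodist z.2 (d i)) := by
    refine (hμ.prod Measure.AbsolutelyContinuous.rfl).ae_le (ae_ae_ae_line
      (P := fun x n => ∀ j i, |f j x n - f j x (d i)| ≤ σ (geodist n (d i))) ?_ fun n => ?_)
    · simp only [ofPred_forall]
      refine MeasurableSet.iInter fun j => MeasurableSet.iInter fun i => ?_
      exact measurableSet_le ((hf j).sub ((hfd j i).comp measurable_fst)).abs
        ((continuous_modulus_geodist hσ (d i)).measurable.comp measurable_snd)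
    · exact ae_all_iff.2 fun j => ae_all_iff.2 fun i => hequi j n i
  set V := (μ.prod (surface : Measure S2)).real univ with hV
  have hV0 : 0 ≤ V := measureReal_nonneg
  rw [Metric.tendsto_nhds]
  intro ε hε
  -- The minimum with 1 gives η² ≤ η. The constant 32 is 2 · 4², from b² ≤ 2c² + 2(b - c)² with |b -
  -- c| ≤ 4η.
  set η := min 1 (ε / (2 * (32 * V + 1))) with hη
  have hη0 : 0 < η := lt_min one_pos (by positivity)
  have hηsq : 32 * V * η ^ 2 < ε / 2 := by
    have h1 : η ^ 2 ≤ η := by nlinarith [min_le_left 1 (ε / (2 * (32 * V + 1)))]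
    have h2 : η * (32 * V + 1) ≤ ε / 2 := by
      have := min_le_right 1 (ε / (2 * (32 * V + 1)))
      calc η * (32 * V + 1) ≤ ε / (2 * (32 * V + 1)) * (32 * V + 1) := by gcongr
        _ = ε / 2 := by field_simp
    nlinarith
  obtain ⟨F, hF⟩ := exists_finset_modulus_lt hσ hσ0 hd hη0
  -- The net point depends on the direction of the line; summing over all of F dominates every
  -- choice.
  have hsum : Tendsto (fun p => ∑ i ∈ F, 2 * ∫ z, c i p z ^ 2 ∂(μ.prod surface)) atTop (𝓝 0) := by
    simpa using tendsto_finsetSum F fun i _ => (hc i).const_mul 2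
  filter_upwards [hsum.eventually_lt_const (half_pos hε)] with p hp
  have hnn : 0 ≤ lineIntSqDist μ (f p.1) (f p.2) := integral_nonneg fun z => sq_nonneg _
  rw [Real.dist_eq, sub_zero, abs_of_nonneg hnn]
  have hle : lineIntSqDist μ (f p.1) (f p.2) ≤
      ∫ z, ((∑ i ∈ F, 2 * c i p z ^ 2) + 32 * η ^ 2) ∂(μ.prod surface) := by
    refine integral_mono_of_nonneg (ae_of_all _ fun z => sq_nonneg _)
      ((integrable_finsetSum F fun i _ => (hci i p).const_mul 2).add (integrable_const _)) ?_
    filter_upwards [hline] with z hz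
    obtain ⟨i, hiF, hi⟩ := hF z.2
    have h1 := abs_lineInt_sub_lineInt_le (hf p.1) (hM p.1) (x := z.1) (n := z.2) (ω := d i)
      (η := η) (hz.mono fun l hl => (hl p.1 i).trans hi.le)
    have h2 := abs_lineInt_sub_lineInt_le (hf p.2) (hM p.2) (x := z.1) (n := z.2) (ω := d i)
      (η := η) (hz.mono fun l hl => (hl p.2 i).trans hi.le)
    have h3 : 2 * c i p z ^ 2 ≤ ∑ i ∈ F, 2 * c i p z ^ 2 :=
      Finset.single_le_sum (f := fun i => 2 * c i p z ^ 2) (fun i _ => by positivity) hiF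
    have h4 := hc_eq i p z
    set b := lineInt z.2 (f p.1) z.1 z.2 - lineInt z.2 (f p.2) z.1 z.2 with hb
    have h5 : |b - c i p z| ≤ 4 * η := by
      rw [h4, hb, abs_le]
      rw [abs_le] at h1 h2
      constructor <;> linarith
    have h6 : (b - c i p z) ^ 2 ≤ (4 * η) ^ 2 := by
      rw [← sq_abs]; exact pow_le_pow_left₀ (abs_nonneg _) h5 2
    change b ^ 2 ≤ _
    -- 2c² + 2(b - c)² - b² = (b - 2c)².
    nlinarith [sq_nonneg (b - 2 * c i p z)]
  rw [integral_add (integrable_finsetSum F fun i _ => (hci i p).const_mul 2)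
    (integrable_const _), integral_finsetSum F fun i _ => (hci i p).const_mul 2,
    integral_const, smul_eq_mul, ← hV] at hle
  simp only [integral_const_mul] at hle
  linarith

theorem cauchySeq_toLp_T {f : ℕ → E3 → S2 → ℝ} {M : ℝ} {μ : Measure E3} [IsFiniteMeasure μ]
    (hf : ∀ j, Measurable (Function.uncurry (f j))) (hM : ∀ j x n, |f j x n| ≤ M)
    (h : Tendsto (fun p : ℕ × ℕ => lineIntSqDist μ (f p.1) (f p.2)) atTop (𝓝 0)) (m : ℕ) :
    CauchySeq fun j => (memLp_T (hf j) (hM j) m μ 2).toLp (T m (f j)) := by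
  rw [cauchySeq_iff_tendsto_dist_atTop_0]
  have h1 := h.const_mul
    ((surface : Measure S2).real univ * (m * (2 * M) ^ (m - 1)) ^ 2)
  rw [mul_zero] at h1
  have h2 := h1.sqrt
  rw [Real.sqrt_zero] at h2
  refine squeeze_zero (fun _ => dist_nonneg) (fun p => Real.le_sqrt_of_sq_le ?_) h2
  rw [dist_eq_norm, ← MemLp.toLp_sub, norm_toLp_sq]
  exact integral_sq_T_sub_T_le (hf _) (hM _) (hf _) (hM _) m μ

/-- This is what makes T_m independent of the representative. -/
theorem lineInt_ae_eq (hL : 0 < L) {φ : S2 → Lp ℝ ∞ (cubeMeasure L)} {f g : E3 → S2 → ℝ}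
    (hf : IsPeriodicRepresentative L φ f) (hg : IsPeriodicRepresentative L φ g) :
    ∀ᵐ x : E3, ∀ᵐ n : S2 ∂surface, ∀ᵐ l : ℝ, f (x - l • (n : E3)) n = g (x - l • (n : E3)) n :=
  Measure.ae_ae_of_ae_prod (ae_ae_ae_line (P := fun x n => f x n = g x n)
    (measurableSet_eq_fun hf.measurable hg.measurable)
    (hf.ae_eq_of_isPeriodicRepresentative hL hg))

end LineIntegral

/-! ### Assembly of the theorem -/

theorem mainTheorem7 (L : ℝ) (hL : 0 < L)
    (φ : ℕ → C(LineIntegral.S2, Lp ℝ ∞ (LineIntegral.cubeMeasure L)))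
    (M : ℝ) (hM : ∀ (j : ℕ) (n : LineIntegral.S2), ‖φ j n‖ ≤ M)
    (σ : ℝ → ℝ) (hσ_cont : ContinuousOn σ (Ici 0)) (hσ_nonneg : ∀ t, 0 ≤ t → 0 ≤ σ t)
    (hσ_zero : σ 0 = 0)
    (hφ : ∀ (j : ℕ) (n₁ n₂ : LineIntegral.S2),
      ‖φ j n₁ - φ j n₂‖ ≤ σ (LineIntegral.geodist n₁ n₂)) :
    -- each `φ j` has a periodic, jointly measurable representative
    (∀ j : ℕ, ∃ f, LineIntegral.IsPeriodicRepresentative L (φ j) f) ∧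
    ∀ m : ℕ, ∃ τ : ℕ → Lp ℝ 2 (LineIntegral.cubeMeasure L),
      -- `τ j` is `T_m[φ j]`, whichever representative is used to compute it
      (∀ (j : ℕ) (f : LineIntegral.E3 → LineIntegral.S2 → ℝ),
        LineIntegral.IsPeriodicRepresentative L (φ j) f →
          (∀ᵐ x ∂LineIntegral.cubeMeasure L,
            (∀ᵐ n : LineIntegral.S2 ∂LineIntegral.surface,
              IntervalIntegrable (fun l : ℝ => f (x - l • (n : LineIntegral.E3)) n)
                volume (-1) 1) ∧
            Integrable (fun n : LineIntegral.S2 => LineIntegral.lineInt n f x n ^ m)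
              LineIntegral.surface) ∧
          τ j =ᵐ[LineIntegral.cubeMeasure L] LineIntegral.T m f) ∧
      -- the sequence is relatively compact in `L²(Π³)`
      IsCompact (closure (range τ)) := by
  have hrep := fun j => LineIntegral.exists_bounded_isPeriodicRepresentative hL (φ j) (hM j)
  choose f hf hfM using hrep
  refine ⟨fun j => ⟨f j, hf j⟩, fun m => ⟨fun j =>
    (LineIntegral.memLp_T (hf j).measurable (hfM j) m (LineIntegral.cubeMeasure L) 2).toLp _,
    fun j g hg => ?_, ?_⟩⟩
  · have hac := ae_restrict_of_ae (s := LineIntegral.cube L)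
      (LineIntegral.lineInt_ae_eq hL (hf j) hg)
    have hl : ∀ (x : LineIntegral.E3) (n : LineIntegral.S2), (∀ᵐ l : ℝ, f j (x - l • (n : LineIntegral.E3)) n =
        g (x - l • (n : LineIntegral.E3)) n) →
        LineIntegral.lineInt n (f j) x n = LineIntegral.lineInt n g x n := fun x n h =>
      intervalIntegral.integral_congr_ae (h.mono fun l hl _ => hl)
    refine ⟨?_, ?_⟩
    · filter_upwards [hac] with x hx
      refine ⟨?_, ?_⟩
      · filter_upwards [hx] with n hn
        exact (LineIntegral.intervalIntegrable_line (hf j).measurable (hfM j) x n n).congr_ae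
          (ae_restrict_of_ae hn)
      · refine (LineIntegral.integrable_lineInt_pow (hf j).measurable (hfM j) m x).congr ?_
        filter_upwards [hx] with n hn
        rw [hl x n hn]
    · refine (MemLp.coeFn_toLp _).trans ?_
      filter_upwards [hac] with x hx
      refine integral_congr_ae ?_
      filter_upwards [hx] with n hn
      rw [hl x n hn]
  · refine LineIntegral.isCompact_closure_range_of_cauchySeq fun ι => ?_
    have : Nonempty LineIntegral.S2 := ⟨⟨EuclideanSpace.single 0 1, by simp⟩⟩
    let d := TopologicalSpace.denseSeq LineIntegral.S2
    have : Fact ((1 : ℝ≥0∞) ≠ ∞) := ⟨ENNReal.one_ne_top⟩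
    -- The index of the dense direction is treated as an extra variable, so a single extraction
    -- covers all directions.
    obtain ⟨θ, hθ, hlim⟩ := LineIntegral.exists_subseq_tendsto_integral_mul
      (μ := (volume : Measure LineIntegral.E3).prod (Measure.count : Measure ℕ))
      (h := fun k (q : LineIntegral.E3 × ℕ) => f (ι k) q.1 (d q.2)) (M := M)
      (fun k => (hf (ι k)).measurable.comp
        (measurable_fst.prodMk ((measurable_of_countable d).comp measurable_snd)))
      (fun k q => hfM _ _ _)
    refine ⟨θ, hθ, LineIntegral.cauchySeq_toLp_T (f := fun k => f (ι (θ k)))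
      (fun k => (hf (ι (θ k))).measurable) (fun k => hfM (ι (θ k))) ?_ m⟩
    refine LineIntegral.tendsto_lineIntSqDist (f := fun k => f (ι (θ k))) (M := M) (d := d) (fun k => (hf (ι (θ k))).measurable) (fun k => hfM (ι (θ k)))
      hσ_cont hσ_zero (TopologicalSpace.denseRange_denseSeq LineIntegral.S2)
      (fun k n i => ?_) (fun i g hg => ?_) _ Measure.absolutelyContinuous_restrict
    · exact ((hf _).ae_abs_sub_le hL n (d i)).mono fun x hx => hx.trans (hφ _ _ _)
    · obtain ⟨c, hc⟩ := hlim _ (LineIntegral.integrable_mul_indicator_singleton hg i)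
      have h1 : ∀ k, _ := fun k => LineIntegral.integral_mul_indicator_singleton
        (h := fun x n => f (ι (θ k)) x (d n)) (μ := volume) (M := M)
        (fun n => (hf _).measurable.comp (measurable_id.prodMk measurable_const))
        (fun x n => hfM _ _ _) hg i
      exact ⟨c, by simpa only [h1] using hc⟩
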